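/- Let $n\ge 3$, and let $(s_t)_{t\ge 0}$ be a binary m-sequence of order $n$, that is, a sequence over $\mathbb F_2$, not identically zero, satisfying a linear recurrence $$s_{t+n}=c_{n-1}s_{t+n-1}+\dots+c_1s_{t+1}+c_0s_t\qquad(t\ge 0)$$ with $c_0,\dots,c_{n-1}\in\mathbb F_2$ whose characteristic polynomial $x^n+c_{n-1}x^{n-1}+\dots+c_1x+c_0\in\mathbb F_2[x]$ is primitive, i.e. is the minimal polynomial over $\mathbb F_2$ of an element of $\mathbb F_{2^n}$ of multiplicative order $2^n-1$. For $1\le t\le 2^n-1$ let $$G_t=\begin{pmatrix} s_0&s_1&\cdots&s_{t-1}\\ s_1&s_2&\cdots&s_t\\ \vdots&\vdots&\ddots&\vdots\\ s_{n-1}&s_n&\cdots&s_{n+t-2}\end{pmatrix}\in\mathbb F_2^{\,n\times t}$$ be the associated observability matrix. Then, with the rank taken over $\mathbb F_2$, $$\#\{\,1\le t\le 2^n-1 \mid \operatorname{rank}(G_tG_t^{\top})=k\,\}=\begin{cases}1,&k=0,\\ 2,&k=1,\\ 2^{k-1},&2\le k\le n-1,\\ 2^{n-1}-2,&k=n.\end{cases}$$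 -/

import Mathlib

open Polynomial

/-- A binary polynomial `f` is primitive of degree `n` if it has degree `n` and is the minimal
polynomial over `𝔽₂` of a primitive element of `𝔽_{2^n}`, that is, of an element of
multiplicative order `2^n - 1`. -/
def IsPrimitivePolynomial (n : ℕ) (f : (ZMod 2)[X]) : Prop :=
  f.natDegree = n ∧
    ∃ α : GaloisField 2 n, orderOf α = 2 ^ n - 1 ∧ minpoly (ZMod 2) α = f

/-- `s` is a binary m-sequence of order `n`: a nonzero sequence over `𝔽₂` that satisfies
`s (t + n) = c₀ * s t + c₁ * s (t + 1) + ⋯ + cₙ₋₁ * s (t + n - 1)` for all `t ≥ 0`, where the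
characteristic polynomial of the recurrence is primitive of degree `n`. -/
def IsMSequence (n : ℕ) (s : ℕ → ZMod 2) : Prop :=
  s ≠ 0 ∧ ∃ E : LinearRecurrence (ZMod 2),
    E.order = n ∧ IsPrimitivePolynomial n E.charPoly ∧ E.IsSolution s

/-- The `n × t` observability matrix of `s`, with `(i, j)` entry `s (i + j)` (indices from `0`). -/
def observabilityMatrix (s : ℕ → ZMod 2) (n t : ℕ) : Matrix (Fin n) (Fin t) (ZMod 2) :=
  Matrix.of fun i j => s (i + j)

/-- `r_n(t)`: the rank over `𝔽₂` of the Gram matrix `G_t * G_tᵀ` of the observability matrix. -/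
noncomputable def gramRank (s : ℕ → ZMod 2) (n t : ℕ) : ℕ :=
  (observabilityMatrix s n t * (observabilityMatrix s n t).transpose).rank

/-- The number of `t` with `1 ≤ t ≤ 2^n - 1` such that the Gram matrix has rank `k`. -/
noncomputable def gramRankCount (s : ℕ → ZMod 2) (n k : ℕ) : ℕ :=
  ((Finset.Icc 1 (2 ^ n - 1)).filter fun t => gramRank s n t = k).card

/-!
Let `α` be the root of the characteristic polynomial in `F = 𝔽_{2^n}`. Every element of `F` is `w(α)`
for a unique polynomial `w` of degree less than `n`; let `φ` be the linear map `w(α) ↦ w(α⁻¹)`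
(`invMap`) and `λ` the functional reading off the coefficient of `α ^ (n - 1)` (`topCoeff`). Reducing
`X * w` modulo the minimal polynomial gives `α φ(α y) - φ(y) = λ(y) m` with a constant `m`, nonzero
because `α⁻¹` is not conjugate to `α` when `n ≥ 3`. The sequence is `s i = λ(α ^ i b)` for some
`b ≠ 0`, so the Gram matrix is, up to equivalence, `y ↦ ∑ j < t, λ(α ^ j y) α ^ j`, and `m` times
this sum telescopes to `α ^ t φ(α ^ t y) - φ(y)` (`gramRank_eq`).

The kernel therefore consists of the `w(α)` for which some `u`, with `u` and `w` of degree less than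
`n`, has `u / w` equal to `α ^ t` at `α` and to `α⁻¹ ^ t` at `α⁻¹`. A polynomial of degree less than
`2 * n` vanishing at `α` and `α⁻¹` is zero, so all such fractions have the same lowest terms `u₀ / w₀`,
and the rank is `max (deg u₀) (deg w₀) = k` if it is less than `n` (`finrank_range_shiftDiff`).
Replacing `X` by `X⁻¹` inverts the fraction, which forces `w₀` to be the reversal of `u₀` as a form of
degree `k` (`coprimeToReversal_of_ratioEqPow`). Conversely every form of degree `k < n` coprime to
its reversal arises from exactly one `t`, as `α` generates `Fˣ` (`gramRankCount_eq`).

It remains to count the binary forms of degree `k` coprime to their reversal. Every nonzero form is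
uniquely a palindromic form times such a form, which gives the recursion
`sum_card_coprimeForms_mul` and from it the numbers `1, 2, 2, 4, 8, …`. Full rank accounts for the
remaining values of `t`.
-/

/-! ### Binary forms and their reversals -/

/-- The only unit of `𝔽₂[X]` is `1`. -/
theorem eq_of_dvd_of_dvd {p q : (ZMod 2)[X]} (h : p ∣ q) (h' : q ∣ p) : p = q := by
  by_cases hp : p = 0
  · subst hp; exact (zero_dvd_iff.1 h).symm
  have hq : q ≠ 0 := fun hq => hp (zero_dvd_iff.1 (hq ▸ h'))
  have key : ∀ a : ZMod 2, a ≠ 0 → a = 1 := by decide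
  exact eq_of_monic_of_associated (key _ (leadingCoeff_ne_zero.2 hp))
    (key _ (leadingCoeff_ne_zero.2 hq)) (associated_of_dvd_dvd h h')

theorem eq_of_dvd_of_natDegree_le_natDegree {p q : (ZMod 2)[X]} (h : p ∣ q) (hq : q ≠ 0)
    (hd : q.natDegree ≤ p.natDegree) : p = q := by
  obtain ⟨c, rfl⟩ := h
  have hp : p ≠ 0 := left_ne_zero_of_mul hq
  have hc : c ≠ 0 := right_ne_zero_of_mul hq
  rw [natDegree_mul hp hc] at hd
  have hc1 : IsUnit c := by
    rw [isUnit_iff_degree_eq_zero, degree_eq_natDegree hc]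
    have : c.natDegree = 0 := by omega
    simp [this]
  exact eq_of_dvd_of_dvd (dvd_mul_right _ _) (by
    obtain ⟨d, hd⟩ := hc1.exists_right_inv
    exact ⟨d, by rw [mul_assoc, hd, mul_one]⟩)

theorem exists_eq_mul_isCoprime (u : (ZMod 2)[X]) {w : (ZMod 2)[X]} (hw : w ≠ 0) :
    ∃ g v v' : (ZMod 2)[X], IsCoprime v v' ∧ u = g * v ∧ w = g * v' := by
  classical
  obtain ⟨v, hv⟩ := EuclideanDomain.gcd_dvd_left u w
  obtain ⟨v', hv'⟩ := EuclideanDomain.gcd_dvd_right u w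
  have hg : EuclideanDomain.gcd u w ≠ 0 := fun h0 => hw (by rw [hv', h0, zero_mul])
  refine ⟨_, v, v', ⟨EuclideanDomain.gcdA u w, EuclideanDomain.gcdB u w, mul_left_cancel₀ hg ?_⟩,
    hv, hv'⟩
  have := EuclideanDomain.gcd_eq_gcd_ab u w
  linear_combination (-1 : (ZMod 2)[X]) * this - EuclideanDomain.gcdA u w * hv
    - EuclideanDomain.gcdB u w * hv'

theorem natDegree_reflect_le_of_le {p : (ZMod 2)[X]} {k : ℕ} (h : p.natDegree ≤ k) :
    (reflect k p).natDegree ≤ k :=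
  natDegree_reflect_le.trans (by simp [h])

/-- Coprimality gives `v ∣ reflect k w` and `w ∣ reflect k v`; whichever of `v` and `w` has the full
degree `k` then equals the multiple it divides. -/
theorem reflect_eq_of_isCoprime {v w : (ZMod 2)[X]} {k : ℕ} (hvw : IsCoprime v w)
    (hk : max v.natDegree w.natDegree = k) (h : v * reflect k v = w * reflect k w) :
    reflect k v = w := by
  have hv : v.natDegree ≤ k := hk ▸ le_max_left _ _
  have hw : w.natDegree ≤ k := hk ▸ le_max_right _ _
  rcases max_choice v.natDegree w.natDegree with hm | hm
  · have h1 : v ∣ reflect k w := hvw.dvd_of_dvd_mul_left ⟨_, h.symm⟩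
    by_cases hw0 : w = 0
    · subst hw0
      rw [zero_mul, mul_eq_zero, reflect_eq_zero_iff, or_self] at h
      simp [h]
    have := eq_of_dvd_of_natDegree_le_natDegree h1 (by rwa [Ne, reflect_eq_zero_iff])
      ((natDegree_reflect_le_of_le hw).trans (by omega))
    rw [this, reflect_reflect]
  · have h1 : w ∣ reflect k v := hvw.symm.dvd_of_dvd_mul_left ⟨_, h⟩
    by_cases hv0 : v = 0
    · subst hv0
      rw [zero_mul, eq_comm, mul_eq_zero, reflect_eq_zero_iff, or_self] at h
      simp [h]
    exact (eq_of_dvd_of_natDegree_le_natDegree h1 (by rwa [Ne, reflect_eq_zero_iff])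
      ((natDegree_reflect_le_of_le hv).trans (by omega))).symm

theorem finite_natDegree_le (k : ℕ) : {p : (ZMod 2)[X] | p.natDegree ≤ k}.Finite := by
  have : Finite (degreeLT (ZMod 2) (k + 1)) := Finite.of_equiv _ (degreeLTEquiv _ _).symm.toEquiv
  refine (Set.toFinite (degreeLT (ZMod 2) (k + 1) : Set (ZMod 2)[X])).subset fun p hp => ?_
  rw [SetLike.mem_coe, degreeLT_succ_eq_degreeLE, mem_degreeLE]
  exact natDegree_le_iff_degree_le.1 hp

/-- The binary polynomials of degree at most `k`. -/
noncomputable def polysLE (k : ℕ) : Finset (ZMod 2)[X] := (finite_natDegree_le k).toFinset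

@[simp] theorem mem_polysLE {k : ℕ} {p : (ZMod 2)[X]} : p ∈ polysLE k ↔ p.natDegree ≤ k := by
  simp [polysLE]

theorem coeff_sum_fin {k : ℕ} (c : Fin (k + 1) → ZMod 2) (i : ℕ) :
    (∑ j : Fin (k + 1), C (c j) * X ^ (j : ℕ)).coeff i = if h : i < k + 1 then c ⟨i, h⟩ else 0 := by
  simp only [finsetSum_coeff, coeff_C_mul, coeff_X_pow, mul_ite, mul_one, mul_zero]
  split_ifs with h
  · rw [Finset.sum_eq_single ⟨i, h⟩]
    · simp
    · intro b _ hb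
      rw [if_neg]
      rintro rfl
      exact hb rfl
    · simp
  · refine Finset.sum_eq_zero fun j _ => if_neg ?_
    have := j.2
    omega

theorem card_polysLE (k : ℕ) : (polysLE k).card = 2 ^ (k + 1) := by
  have : (polysLE k).card = (Finset.univ : Finset (Fin (k + 1) → ZMod 2)).card := by
    refine Finset.card_bij' (fun p _ i => p.coeff i)
      (fun c _ => ∑ j : Fin (k + 1), C (c j) * X ^ (j : ℕ)) (by simp) ?_ ?_ ?_
    · intro c _
      rw [mem_polysLE, natDegree_le_iff_coeff_eq_zero]
      intro i hi
      rw [coeff_sum_fin, dif_neg (by omega)]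
    · intro p hp
      ext i
      rw [coeff_sum_fin]
      split_ifs with h
      · rfl
      · exact (coeff_eq_zero_of_natDegree_lt (by rw [mem_polysLE] at hp; omega)).symm
    · intro c _
      ext i
      rw [coeff_sum_fin, dif_pos i.2]
  rw [this, Finset.card_univ, Fintype.card_fun, ZMod.card, Fintype.card_fin]

open Classical in
/-- The binary polynomials that are palindromic as forms of degree `k`: the leading coefficients may
vanish, and `0` is included. -/
noncomputable def palindromes (k : ℕ) : Finset (ZMod 2)[X] :=
  (polysLE k).filter fun g => reflect k g = g

theorem card_palindromes (k : ℕ) : (palindromes k).card = 2 ^ (k / 2 + 1) := by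
  have : (palindromes k).card = (Finset.univ : Finset (Fin (k / 2 + 1) → ZMod 2)).card := by
    refine Finset.card_bij' (fun p _ i => p.coeff i)
      (fun c _ => ∑ j : Fin (k + 1), C (c ⟨min j (k - j), by omega⟩) * X ^ (j : ℕ))
      (by simp) ?_ ?_ ?_
    · intro c _
      rw [palindromes, Finset.mem_filter, mem_polysLE, natDegree_le_iff_coeff_eq_zero]
      refine ⟨fun i hi => ?_, ?_⟩
      · rw [coeff_sum_fin, dif_neg (by omega)]
      · ext i
        rw [coeff_reflect, coeff_sum_fin, coeff_sum_fin]
        rcases le_or_gt i k with h | h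
        · rw [revAt_le h, dif_pos (by omega), dif_pos (by omega)]
          congr 2
          simp only
          omega
        · rw [revAt_eq_self_of_lt h]
    · intro p hp
      rw [palindromes, Finset.mem_filter, mem_polysLE] at hp
      ext i
      rw [coeff_sum_fin]
      split_ifs with h
      · simp only
        rcases le_total i (k - i) with h' | h'
        · rw [min_eq_left h']
        · rw [min_eq_right h', ← revAt_le (by omega), ← coeff_reflect, hp.2]
      · exact (coeff_eq_zero_of_natDegree_lt (by omega)).symm
    · intro c _
      ext i
      have := i.2
      rw [coeff_sum_fin, dif_pos (by omega)]
      congr 1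
      ext
      simp only
      omega
  rw [this, Finset.card_univ, Fintype.card_fun, ZMod.card, Fintype.card_fin]

/-- `v`, read as a binary form of degree `k`, is coprime to its reversal. The condition on degrees
excludes a common zero of the two forms at infinity. -/
def CoprimeToReversal (k : ℕ) (v : (ZMod 2)[X]) : Prop :=
  IsCoprime v (reflect k v) ∧ max v.natDegree (reflect k v).natDegree = k

theorem CoprimeToReversal.natDegree_le {k : ℕ} {v : (ZMod 2)[X]} (h : CoprimeToReversal k v) :
    v.natDegree ≤ k := h.2 ▸ le_max_left _ _

theorem CoprimeToReversal.ne_zero {k : ℕ} {v : (ZMod 2)[X]} (h : CoprimeToReversal k v) :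
    v ≠ 0 := by
  rintro rfl
  have := h.1
  rw [reflect_zero] at this
  exact not_isCoprime_zero_zero this

open Classical in
/-- The binary forms of degree `k` coprime to their reversal. -/
noncomputable def coprimeForms (k : ℕ) : Finset (ZMod 2)[X] :=
  (polysLE k).filter (CoprimeToReversal k)

@[simp] theorem mem_coprimeForms {k : ℕ} {v : (ZMod 2)[X]} :
    v ∈ coprimeForms k ↔ CoprimeToReversal k v := by
  simp only [coprimeForms, Finset.mem_filter, mem_polysLE, and_iff_right_iff_imp]
  exact fun h => h.natDegree_le

theorem mem_palindromes {k : ℕ} {g : (ZMod 2)[X]} :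
    g ∈ palindromes k ↔ g.natDegree ≤ k ∧ reflect k g = g := by
  simp [palindromes]

/-- The fraction `v / reflect k v`, in lowest terms, determines both `v` and `k`. -/
theorem eq_of_mul_reflect_eq {i j : ℕ} {v w : (ZMod 2)[X]} (hv : CoprimeToReversal i v)
    (hw : CoprimeToReversal j w) (h : v * reflect j w = w * reflect i v) : v = w ∧ i = j := by
  have h1 : v = w := eq_of_dvd_of_dvd (hv.1.dvd_of_dvd_mul_right ⟨_, h.symm⟩)
    (hw.1.dvd_of_dvd_mul_right ⟨_, h⟩)
  subst h1
  refine ⟨rfl, ?_⟩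
  have h2 := mul_left_cancel₀ hv.ne_zero h
  rw [← hv.2, ← hw.2, h2]

/-- The palindromic factor is the affine gcd `g` of `u` and its reversal. A common zero at infinity
is absorbed by reading `g` as a form of degree `k - j`, which may exceed its degree as a
polynomial. -/
theorem exists_mul_palindrome {k : ℕ} {u : (ZMod 2)[X]} (hu : u ≠ 0) (hk : u.natDegree ≤ k) :
    ∃ j ≤ k, ∃ v g, CoprimeToReversal j v ∧ g ∈ palindromes (k - j) ∧ u = g * v := by
  set u' := reflect k u with hu'
  have hu'0 : u' ≠ 0 := by rwa [Ne, reflect_eq_zero_iff]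
  have hk' : u'.natDegree ≤ k := natDegree_reflect_le_of_le hk
  obtain ⟨g, v, w, hvw, hv, hw⟩ := exists_eq_mul_isCoprime u hu'0
  have hg0 : g ≠ 0 := by rintro rfl; exact hu (by simpa using hv)
  have hv0 : v ≠ 0 := by rintro rfl; exact hu (by simpa using hv)
  have hw0 : w ≠ 0 := by rintro rfl; exact hu'0 (by simpa using hw)
  have hdv : g.natDegree + v.natDegree ≤ k := by rw [← natDegree_mul hg0 hv0, ← hv]; exact hk
  have hdw : g.natDegree + w.natDegree ≤ k := by rw [← natDegree_mul hg0 hw0, ← hw]; exact hk'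
  obtain ⟨j, hj⟩ : ∃ j, max v.natDegree w.natDegree = j := ⟨_, rfl⟩
  have hjv : v.natDegree ≤ j := by omega
  have hjw : w.natDegree ≤ j := by omega
  have hgj : g.natDegree ≤ k - j := by omega
  have hjk : k - j + j = k := by omega
  have e1 : g * w = reflect (k - j) g * reflect j v := by
    rw [← reflect_mul g v hgj hjv, hjk, ← hv, ← hw]
  have e2 : g * v = reflect (k - j) g * reflect j w := by
    rw [← reflect_mul g w hgj hjw, hjk, ← hv, ← hw, hu', reflect_reflect]
  have hg'0 : reflect (k - j) g ≠ 0 := by rwa [Ne, reflect_eq_zero_iff]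
  have hr : reflect j v = w := by
    refine reflect_eq_of_isCoprime hvw hj (mul_left_cancel₀ (mul_ne_zero hg0 hg'0) ?_)
    linear_combination reflect (k - j) g * reflect j v * e2 -
      reflect (k - j) g * reflect j w * e1
  refine ⟨j, by omega, v, g, ⟨hr ▸ hvw, hr ▸ hj⟩, mem_palindromes.2 ⟨hgj, ?_⟩, hv⟩
  rw [hr] at e1
  exact (mul_right_cancel₀ hw0 e1).symm

/-- Every nonzero form of degree `k` is uniquely a palindromic form times a form coprime to its
reversal. -/
theorem sum_card_coprimeForms_mul (k : ℕ) :
    ∑ j ∈ Finset.range (k + 1), (coprimeForms j).card * (2 ^ ((k - j) / 2 + 1) - 1) =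
      2 ^ (k + 1) - 1 := by
  classical
  have hP : ∀ m, ((palindromes m).erase 0).card = 2 ^ (m / 2 + 1) - 1 := fun m => by
    rw [Finset.card_erase_of_mem (by simp [mem_palindromes]), card_palindromes]
  have hU : ((polysLE k).erase 0).card = 2 ^ (k + 1) - 1 := by
    rw [Finset.card_erase_of_mem (by simp), card_polysLE]
  simp_rw [← hU, ← hP, ← Finset.card_product]
  rw [← Finset.card_sigma]
  refine Finset.card_bij (fun x _ => x.2.2 * x.2.1) ?_ ?_ ?_
  · rintro ⟨j, v, g⟩ h
    simp only [Finset.mem_sigma, Finset.mem_range, Finset.mem_product, mem_coprimeForms,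
      Finset.mem_erase, mem_palindromes, mem_polysLE] at h ⊢
    obtain ⟨hj, hv, hg0, hg, -⟩ := h
    refine ⟨mul_ne_zero hg0 hv.ne_zero, natDegree_mul_le.trans ?_⟩
    have := hv.natDegree_le
    omega
  · rintro ⟨i, v, g⟩ h ⟨j, w, f⟩ h' e
    simp only [Finset.mem_sigma, Finset.mem_range, Finset.mem_product, mem_coprimeForms,
      Finset.mem_erase, mem_palindromes] at h h' e
    obtain ⟨hi, hv, hg0, hg, hgr⟩ := h
    obtain ⟨hj, hw, hf0, hf, hfr⟩ := h'
    have e' : g * reflect i v = f * reflect j w := by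
      have := congrArg (reflect k) e
      rwa [show k = k - i + i by omega, reflect_mul _ _ hg hv.natDegree_le, hgr,
        show k - i + i = k - j + j by omega, reflect_mul _ _ hf hw.natDegree_le, hfr] at this
    obtain ⟨rfl, rfl⟩ : v = w ∧ i = j := by
      refine eq_of_mul_reflect_eq hv hw (mul_left_cancel₀ (mul_ne_zero hg0 hf0) ?_)
      linear_combination f * reflect j w * e - f * w * e'
    obtain rfl := mul_right_cancel₀ hv.ne_zero e
    rfl
  · intro u hu
    rw [Finset.mem_erase, mem_polysLE] at hu
    obtain ⟨j, hj, v, g, hv, hg, rfl⟩ := exists_mul_palindrome hu.1 hu.2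
    refine ⟨⟨j, v, g⟩, ?_, rfl⟩
    simp only [Finset.mem_sigma, Finset.mem_range, Finset.mem_product, mem_coprimeForms,
      Finset.mem_erase]
    exact ⟨by omega, hv, left_ne_zero_of_mul hu.1, hg⟩

theorem card_coprimeForms_zero : (coprimeForms 0).card = 1 := by
  simpa using sum_card_coprimeForms_mul 0

theorem card_coprimeForms_one : (coprimeForms 1).card = 2 := by
  have := sum_card_coprimeForms_mul 1
  simp [Finset.sum_range_succ, card_coprimeForms_zero] at this
  omega

/-- Write `S k` for the sum in `sum_card_coprimeForms_mul`. The weight `2 ^ (m / 2 + 1) - 1` doubles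
and increases by `1` when `m` increases by `2`, so `S (k + 2) - 2 * S k` is the unweighted sum of
the numbers of coprime forms of degree at most `k + 2`. -/
theorem sum_card_coprimeForms {k : ℕ} (hk : 1 ≤ k) :
    ∑ j ∈ Finset.range (k + 1), (coprimeForms j).card = 2 ^ k + 1 := by
  obtain rfl | ⟨m, rfl⟩ : k = 1 ∨ ∃ m, k = m + 2 :=
    (eq_or_lt_of_le' hk).imp_right fun h => ⟨k - 2, by omega⟩
  · simp [Finset.sum_range_succ, card_coprimeForms_zero, card_coprimeForms_one]
  have h1 := sum_card_coprimeForms_mul m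
  have h2 := sum_card_coprimeForms_mul (m + 2)
  have h3 : ∑ j ∈ Finset.range (m + 1), (coprimeForms j).card * (2 ^ ((m + 2 - j) / 2 + 1) - 1) =
      2 * (∑ j ∈ Finset.range (m + 1), (coprimeForms j).card * (2 ^ ((m - j) / 2 + 1) - 1)) +
        ∑ j ∈ Finset.range (m + 1), (coprimeForms j).card := by
    rw [Finset.mul_sum, ← Finset.sum_add_distrib]
    refine Finset.sum_congr rfl fun j hj => ?_
    rw [Finset.mem_range] at hj
    rw [show (m + 2 - j) / 2 + 1 = (m - j) / 2 + 1 + 1 by omega, pow_succ _ ((m - j) / 2 + 1)]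
    obtain ⟨a, ha⟩ : ∃ a, 2 ^ ((m - j) / 2 + 1) = a + 1 := Nat.exists_eq_add_one.2 (by positivity)
    rw [ha, show (a + 1) * 2 - 1 = 2 * a + 1 by omega, Nat.add_sub_cancel]
    ring
  rw [Finset.sum_range_succ, Finset.sum_range_succ, h3, h1] at h2
  rw [Finset.sum_range_succ, Finset.sum_range_succ]
  rw [show (m + 2 - (m + 1)) / 2 + 1 = 1 by omega, show (m + 2 - (m + 2)) / 2 + 1 = 1 by omega] at h2
  have h4 : 2 ^ (m + 2 + 1) = 4 * 2 ^ (m + 1) := by ring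
  have h5 : 2 ^ (m + 2) = 2 * 2 ^ (m + 1) := by ring
  have h6 : 0 < 2 ^ (m + 1) := by positivity
  omega

theorem card_coprimeForms {k : ℕ} (hk : 2 ≤ k) : (coprimeForms k).card = 2 ^ (k - 1) := by
  obtain ⟨m, rfl⟩ : ∃ m, k = m + 2 := ⟨k - 2, by omega⟩
  have h1 := sum_card_coprimeForms (k := m + 1) (by omega)
  have h2 := sum_card_coprimeForms (k := m + 2) (by omega)
  rw [Finset.sum_range_succ, h1] at h2
  have h5 : 2 ^ (m + 2) = 2 * 2 ^ (m + 1) := by ring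
  rw [show m + 2 - 1 = m + 1 by omega]
  omega

/-! ### Reduction of the Gram matrix to a linear map of the field -/

variable {F : Type*} [Field F] [Algebra (ZMod 2) F]

/-- `α` is a primitive element of a field of order `2 ^ n`, where `n ≥ 3`. -/
structure IsPrimitiveElement (n : ℕ) (α : F) : Prop where
  three_le : 3 ≤ n
  finrank_eq : Module.finrank (ZMod 2) F = n
  orderOf_eq : orderOf α = 2 ^ n - 1
  natDegree_minpoly : (minpoly (ZMod 2) α).natDegree = n

theorem mem_degreeLT_iff_natDegree_lt {n : ℕ} (hn : 0 < n) {p : (ZMod 2)[X]} :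
    p ∈ degreeLT (ZMod 2) n ↔ p.natDegree < n := by
  by_cases hp : p = 0
  · simp [hp, hn]
  · rw [mem_degreeLT, natDegree_lt_iff_degree_lt hp]

theorem finrank_degreeLT_zmod_two (n : ℕ) : Module.finrank (ZMod 2) (degreeLT (ZMod 2) n) = n := by
  rw [(degreeLTEquiv (ZMod 2) n).finrank_eq, Module.finrank_fin_fun]

theorem aeval_reflect {α : F} (hα : α ≠ 0) {k : ℕ} {v : (ZMod 2)[X]} (hv : v.natDegree ≤ k) :
    aeval α (reflect k v) = α ^ k * aeval α⁻¹ v := by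
  let _ := invertibleOfNonzero hα
  have := eval₂_reflect_mul_pow (algebraMap (ZMod 2) F) α k (reflect k v)
    (natDegree_reflect_le_of_le hv)
  rw [reflect_reflect, invOf_eq_inv] at this
  rw [aeval_def, aeval_def, ← this, mul_comm]

theorem aeval_inv_reflect {α : F} (hα : α ≠ 0) {k : ℕ} {v : (ZMod 2)[X]} (hv : v.natDegree ≤ k) :
    α ^ k * aeval α⁻¹ (reflect k v) = aeval α v := by
  rw [← aeval_reflect hα (natDegree_reflect_le_of_le hv), reflect_reflect]

namespace IsPrimitiveElement

variable {n : ℕ} {α : F} (h : IsPrimitiveElement n α)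
include h

theorem pos : 0 < n := by have := h.three_le; omega

theorem finiteDimensional : FiniteDimensional (ZMod 2) F :=
  FiniteDimensional.of_finrank_pos (h.finrank_eq ▸ h.pos)

theorem finite : Finite F :=
  have := h.finiteDimensional
  Module.finite_of_finite (ZMod 2)

theorem natCard_eq : Nat.card F = 2 ^ n := by
  have := h.finiteDimensional
  rw [Module.natCard_eq_pow_finrank (K := ZMod 2), h.finrank_eq, Nat.card_zmod]

theorem ne_zero : α ≠ 0 := by
  rintro rfl
  have := h.orderOf_eq
  rw [orderOf_zero] at this
  have h2 : 2 ^ 3 ≤ 2 ^ n := Nat.pow_le_pow_right (by norm_num) h.three_le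
  omega

theorem isIntegral : IsIntegral (ZMod 2) α :=
  have := h.finiteDimensional
  .of_finite _ _

/-- The conjugates of `α` are the powers `α ^ 2 ^ i` with `i < n`, and for `n ≥ 3` the number
`2 ^ n - 1` divides no `2 ^ i + 1`; so `α⁻¹` is not a conjugate of `α`. -/
theorem aeval_inv_minpoly_ne_zero : aeval α⁻¹ (minpoly (ZMod 2) α) ≠ 0 := by
  intro h0
  have := h.finiteDimensional
  have := h.finite
  have := Fintype.ofFinite F
  obtain ⟨σ, hσ⟩ := isConjRoot_iff_exists_algEquiv.1
    ((isConjRoot_iff_aeval_eq_zero h.isIntegral).2 h0)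
  obtain ⟨i, rfl⟩ := (FiniteField.bijective_frobeniusAlgEquivOfAlgebraic_pow (ZMod 2) F).2 σ
  have hi : i.1 < n := h.finrank_eq ▸ i.2
  simp only [AlgEquiv.coe_pow, FiniteField.coe_frobeniusAlgEquivOfAlgebraic_iterate,
    ZMod.card] at hσ
  have h1 : α ^ (2 ^ i.1 + 1) = 1 := by
    rw [pow_succ]
    rw [inv_pow] at hσ
    nth_rewrite 2 [← hσ]
    exact mul_inv_cancel₀ (pow_ne_zero _ h.ne_zero)
  have h2 := Nat.le_of_dvd (by positivity) (h.orderOf_eq ▸ orderOf_dvd_of_pow_eq_one h1)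
  obtain ⟨m, rfl⟩ : ∃ m, n = m + 1 := ⟨n - 1, by have := h.pos; omega⟩
  have h3 : 2 ^ i.1 ≤ 2 ^ m := Nat.pow_le_pow_right (by norm_num) (by omega)
  have h4 : 2 ^ 2 ≤ 2 ^ m := Nat.pow_le_pow_right (by norm_num) (by have := h.three_le; omega)
  rw [pow_succ] at h2
  omega

theorem eq_zero_of_aeval {q : (ZMod 2)[X]} (hq : q.natDegree < n) (h0 : aeval α q = 0) :
    q = 0 := by
  by_contra hne
  have := natDegree_le_of_dvd (minpoly.dvd _ _ h0) hne
  rw [h.natDegree_minpoly] at this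
  omega

theorem eq_zero_of_aeval_inv {q : (ZMod 2)[X]} (hq : q.natDegree < n) (h0 : aeval α⁻¹ q = 0) :
    q = 0 := by
  have hq' : q.natDegree ≤ n - 1 := by omega
  rw [← reflect_eq_zero_iff (N := n - 1)]
  apply h.eq_zero_of_aeval
  · have := natDegree_reflect_le_of_le hq'
    have := h.pos
    omega
  · rw [aeval_reflect h.ne_zero hq', h0, mul_zero]

/-- The minimal polynomials of `α` and `α⁻¹` are coprime of degree `n` each. -/
theorem eq_zero_of_aeval_of_aeval_inv {q : (ZMod 2)[X]} (hq : q.natDegree < 2 * n)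
    (h0 : aeval α q = 0) (h1 : aeval α⁻¹ q = 0) : q = 0 := by
  obtain ⟨r, rfl⟩ := minpoly.dvd _ _ h0
  rw [map_mul, mul_eq_zero, or_iff_right h.aeval_inv_minpoly_ne_zero] at h1
  by_cases hr : r = 0
  · rw [hr, mul_zero]
  rw [natDegree_mul (minpoly.ne_zero h.isIntegral) hr, h.natDegree_minpoly] at hq
  rw [h.eq_zero_of_aeval_inv (by omega) h1, mul_zero]

/-- Evaluation at `α` identifies the polynomials of degree less than `n` with the field. -/
noncomputable def evalEquiv : degreeLT (ZMod 2) n ≃ₗ[ZMod 2] F :=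
  have := h.finiteDimensional
  have : FiniteDimensional (ZMod 2) (degreeLT (ZMod 2) n) :=
    (degreeLTEquiv (ZMod 2) n).symm.finiteDimensional
  LinearMap.linearEquivOfInjective
    ((aeval α).toLinearMap ∘ₗ (degreeLT (ZMod 2) n).subtype)
    (by
      rw [← LinearMap.ker_eq_bot, LinearMap.ker_eq_bot']
      rintro ⟨w, hw⟩ h0
      rw [mem_degreeLT_iff_natDegree_lt h.pos] at hw
      exact Subtype.ext (h.eq_zero_of_aeval hw h0))
    (by rw [finrank_degreeLT_zmod_two, h.finrank_eq])

/-- The polynomial of degree less than `n` with a given value at `α`. -/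
noncomputable def rep : F →ₗ[ZMod 2] (ZMod 2)[X] :=
  (degreeLT (ZMod 2) n).subtype ∘ₗ h.evalEquiv.symm.toLinearMap

theorem natDegree_rep_lt (y : F) : (h.rep y).natDegree < n :=
  (mem_degreeLT_iff_natDegree_lt h.pos).1 (h.evalEquiv.symm y).2

theorem aeval_rep (y : F) : aeval α (h.rep y) = y := h.evalEquiv.apply_symm_apply y

theorem rep_aeval {w : (ZMod 2)[X]} (hw : w.natDegree < n) : h.rep (aeval α w) = w :=
  congrArg Subtype.val
    (h.evalEquiv.symm_apply_apply ⟨w, (mem_degreeLT_iff_natDegree_lt h.pos).2 hw⟩)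

/-- The linear map sending `w(α)` to `w(α⁻¹)` for every polynomial `w` of degree less than `n`. -/
noncomputable def invMap : F →ₗ[ZMod 2] F := (aeval α⁻¹).toLinearMap ∘ₗ h.rep

theorem invMap_apply (y : F) : h.invMap y = aeval α⁻¹ (h.rep y) := rfl

/-- The coordinate at `α ^ (n - 1)` in the power basis. -/
noncomputable def topCoeff : F →ₗ[ZMod 2] ZMod 2 := lcoeff (ZMod 2) (n - 1) ∘ₗ h.rep

theorem topCoeff_apply (y : F) : h.topCoeff y = (h.rep y).coeff (n - 1) := rfl

theorem topCoeff_pow : h.topCoeff (α ^ (n - 1)) = 1 := by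
  have : α ^ (n - 1) = aeval α (X ^ (n - 1) : (ZMod 2)[X]) := by simp
  have hn := h.pos
  rw [topCoeff_apply, this, h.rep_aeval (by rw [natDegree_X_pow]; omega), coeff_X_pow_self]

theorem rep_mul (y : F) :
    h.rep (α * y) = X * h.rep y - C (h.topCoeff y) * minpoly (ZMod 2) α := by
  have hn := h.pos
  have hy := h.natDegree_rep_lt y
  have hm := minpoly.monic h.isIntegral
  have hd := h.natDegree_minpoly
  have key : (X * h.rep y - C (h.topCoeff y) * minpoly (ZMod 2) α).natDegree < n := by
    rw [← mem_degreeLT_iff_natDegree_lt hn, mem_degreeLT, degree_lt_iff_coeff_zero]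
    intro i hi
    obtain ⟨j, rfl⟩ : ∃ j, i = j + 1 := ⟨i - 1, by omega⟩
    rw [coeff_sub, coeff_X_mul, coeff_C_mul]
    rcases eq_or_lt_of_le hi with rfl | hlt
    · have : (minpoly (ZMod 2) α).coeff (j + 1) = 1 := by
        rw [← hd, hm.coeff_natDegree]
      rw [this, topCoeff_apply]
      simp
    · rw [coeff_eq_zero_of_natDegree_lt (p := h.rep y) (by omega),
        coeff_eq_zero_of_natDegree_lt (p := minpoly (ZMod 2) α) (by omega), mul_zero, sub_zero]
  rw [← h.rep_aeval key]
  simp [h.aeval_rep]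

/-- The nonzero constant `m` with `α * invMap (α * y) = invMap y + topCoeff y • m`. -/
noncomputable def defect (_ : IsPrimitiveElement n α) : F := -(α * aeval α⁻¹ (minpoly (ZMod 2) α))

theorem defect_ne_zero : h.defect ≠ 0 :=
  neg_ne_zero.2 (mul_ne_zero h.ne_zero h.aeval_inv_minpoly_ne_zero)

theorem mul_invMap_mul (y : F) :
    α * h.invMap (α * y) = h.invMap y + h.topCoeff y • h.defect := by
  rw [invMap_apply, rep_mul, map_sub, map_mul, map_mul, aeval_X, aeval_C, mul_sub,
    mul_inv_cancel_left₀ h.ne_zero, ← invMap_apply, defect, Algebra.smul_def]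
  ring

/-- The map `y ↦ α ^ t * invMap (α ^ t * y) - invMap y`. -/
noncomputable def shiftDiff (t : ℕ) : F →ₗ[ZMod 2] F :=
  LinearMap.mulLeft (ZMod 2) (α ^ t) ∘ₗ h.invMap ∘ₗ LinearMap.mulLeft (ZMod 2) (α ^ t) - h.invMap

theorem shiftDiff_apply (t : ℕ) (y : F) :
    h.shiftDiff t y = α ^ t * h.invMap (α ^ t * y) - h.invMap y := rfl

/-- The sum telescopes by `mul_invMap_mul`. -/
theorem shiftDiff_eq_sum (t : ℕ) (y : F) :
    h.shiftDiff t y = h.defect * ∑ j ∈ Finset.range t, h.topCoeff (α ^ j * y) • α ^ j := by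
  induction t with
  | zero => simp [shiftDiff_apply]
  | succ t ih =>
    rw [Finset.sum_range_succ, mul_add, ← ih, shiftDiff_apply, shiftDiff_apply, pow_succ, mul_assoc,
      show α ^ t * α * y = α * (α ^ t * y) by ring, mul_invMap_mul, Algebra.smul_def,
      Algebra.smul_def]
    ring

theorem eq_zero_of_topCoeff {z : F} (hz : ∀ i < n, h.topCoeff (α ^ i * z) = 0) : z = 0 := by
  by_contra hne
  have key : ∀ y : F, h.topCoeff (y * z) = 0 := by
    intro y
    rw [← h.aeval_rep y, aeval_eq_sum_range' (h.natDegree_rep_lt y), Finset.sum_mul, map_sum]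
    refine Finset.sum_eq_zero fun i hi => ?_
    rw [smul_mul_assoc, map_smul, hz i (Finset.mem_range.1 hi), smul_zero]
  have := key (α ^ (n - 1) * z⁻¹)
  rw [inv_mul_cancel_right₀ hne, h.topCoeff_pow] at this
  exact one_ne_zero this

/-- The map `z ↦ (topCoeff (α ^ i * z))_{i < n}`. -/
noncomputable def window : F →ₗ[ZMod 2] (Fin n → ZMod 2) :=
  LinearMap.pi fun i => h.topCoeff ∘ₗ LinearMap.mulLeft (ZMod 2) (α ^ (i : ℕ))

theorem window_apply (z : F) (i : Fin n) : h.window z i = h.topCoeff (α ^ (i : ℕ) * z) := rfl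

theorem window_injective : Function.Injective h.window := by
  rw [← LinearMap.ker_eq_bot, LinearMap.ker_eq_bot']
  intro z hz
  exact h.eq_zero_of_topCoeff fun i hi => congrFun hz ⟨i, hi⟩

theorem window_surjective : Function.Surjective h.window := by
  have := h.finiteDimensional
  exact (LinearMap.injective_iff_surjective_of_finrank_eq_finrank
    (by rw [h.finrank_eq, Module.finrank_fin_fun])).1 h.window_injective

theorem isSolution_topCoeff (E : LinearRecurrence (ZMod 2)) (hE : aeval α E.charPoly = 0) (b : F) :
    E.IsSolution fun i => h.topCoeff (α ^ i * b) := by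
  intro i
  change h.topCoeff (α ^ (i + E.order) * b) = ∑ j, E.coeffs j * h.topCoeff (α ^ (i + (j : ℕ)) * b)
  simp only [LinearRecurrence.charPoly, map_sub, map_sum, aeval_monomial, map_one, one_mul,
    sub_eq_zero] at hE
  rw [pow_add, hE, Finset.mul_sum, Finset.sum_mul, map_sum]
  refine Finset.sum_congr rfl fun j _ => ?_
  rw [← smul_eq_mul (E.coeffs j), ← map_smul, Algebra.smul_def]
  congr 1
  ring

/-- As `window` is bijective, `b` can be chosen to match the first `n` terms of `s`, and these determine
a solution of the recurrence. -/
theorem exists_eq_topCoeff (E : LinearRecurrence (ZMod 2)) (hE : aeval α E.charPoly = 0)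
    (hn : E.order = n) {s : ℕ → ZMod 2} (hs : E.IsSolution s) (hs0 : s ≠ 0) :
    ∃ b ≠ 0, ∀ i, s i = h.topCoeff (α ^ i * b) := by
  obtain ⟨b, hb⟩ := h.window_surjective fun i => s i
  have key : s = fun i => h.topCoeff (α ^ i * b) := by
    rw [E.eq_iff_eqOn_range_order s _ hs (h.isSolution_topCoeff E hE b)]
    intro i hi
    have hi' : i < n := by simpa [hn] using hi
    exact (congrFun hb ⟨i, hi'⟩).symm
  refine ⟨b, ?_, congrFun key⟩
  rintro rfl
  apply hs0
  rw [key]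
  ext i
  simp

/-- Up to linear equivalence the Gram matrix sends `y` to `∑ j < t, topCoeff (b α ^ j y) α ^ j`, which
is `shiftDiff t (b * y)` divided by the defect. -/
theorem gramRank_eq {s : ℕ → ZMod 2} {b : F} (hb : b ≠ 0)
    (hs : ∀ i, s i = h.topCoeff (α ^ i * b)) (t : ℕ) :
    gramRank s n t = Module.finrank (ZMod 2) (LinearMap.range (h.shiftDiff t)) := by
  have hm := h.defect_ne_zero
  let B : (Fin n → ZMod 2) ≃ₗ[ZMod 2] F := (degreeLTEquiv (ZMod 2) n).symm.trans h.evalEquiv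
  have hB : ∀ c, B c = ∑ i, c i • α ^ (i : ℕ) := fun c => by
    change aeval α (∑ i : Fin n, monomial (i : ℕ) (c i)) = _
    simp [aeval_monomial, Algebra.smul_def]
  let L : F →ₗ[ZMod 2] (Fin n → ZMod 2) :=
    h.window ∘ₗ LinearMap.mulLeft (ZMod 2) (b * h.defect⁻¹)
  have hL : Function.Injective L :=
    h.window_injective.comp (mul_right_injective₀ (mul_ne_zero hb (inv_ne_zero hm)))
  let R : (Fin n → ZMod 2) →ₗ[ZMod 2] F := LinearMap.mulLeft (ZMod 2) b ∘ₗ B.toLinearMap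
  have hR : Function.Surjective R :=
    (show Function.Surjective (b * ·) from
      fun y => ⟨b⁻¹ * y, mul_inv_cancel_left₀ hb y⟩).comp B.surjective
  have key : (observabilityMatrix s n t * (observabilityMatrix s n t).transpose).mulVecLin =
      L ∘ₗ h.shiftDiff t ∘ₗ R := by
    refine LinearMap.ext fun c => funext fun i => ?_
    have h1 : ∀ j : ℕ, ∑ k : Fin n, s (k + j) * c k = h.topCoeff (α ^ j * (b * B c)) := fun j => by
      rw [hB, Finset.mul_sum, Finset.mul_sum, map_sum]
      refine Finset.sum_congr rfl fun k _ => ?_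
      rw [hs, mul_smul_comm, mul_smul_comm, map_smul, smul_eq_mul, mul_comm]
      congr 2
      ring
    have h2 : h.window (b * h.defect⁻¹ * h.shiftDiff t (b * B c)) i =
        ∑ j ∈ Finset.range t, s (i + j) * h.topCoeff (α ^ j * (b * B c)) := by
      rw [window_apply, shiftDiff_eq_sum, mul_assoc b, inv_mul_cancel_left₀ hm, Finset.mul_sum,
        Finset.mul_sum, map_sum]
      refine Finset.sum_congr rfl fun j _ => ?_
      rw [hs, mul_smul_comm, mul_smul_comm, map_smul, smul_eq_mul, mul_comm]
      congr 2
      ring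
    change _ = h.window (b * h.defect⁻¹ * h.shiftDiff t (b * B c)) i
    rw [h2, Matrix.mulVecLin_apply, ← Matrix.mulVec_mulVec, ← Fin.sum_univ_eq_sum_range]
    simp only [Matrix.mulVec, dotProduct, observabilityMatrix, Matrix.transpose_apply,
      Matrix.of_apply, h1]
  rw [gramRank, Matrix.rank, key, LinearMap.range_comp,
    LinearMap.range_comp_of_range_eq_top _ (LinearMap.range_eq_top.2 hR)]
  exact (Submodule.equivMapOfInjective L hL _).finrank_eq.symm

end IsPrimitiveElement

/-! ### The kernel and fractions of small degree -/


/-- `u / w` takes the value `α ^ t` at `α` and `α⁻¹ ^ t` at `α⁻¹`, with denominators cleared: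
`u = w = 0` is allowed. -/
def RatioEqPow (α : F) (t : ℕ) (u w : (ZMod 2)[X]) : Prop :=
  aeval α u = α ^ t * aeval α w ∧ aeval α⁻¹ w = α ^ t * aeval α⁻¹ u

namespace IsPrimitiveElement

variable {n : ℕ} {α : F} (h : IsPrimitiveElement n α)
include h

theorem mem_ker_shiftDiff {t : ℕ} {y : F} :
    y ∈ LinearMap.ker (h.shiftDiff t) ↔
      ∃ u w : (ZMod 2)[X], u.natDegree < n ∧ w.natDegree < n ∧ aeval α w = y ∧
        RatioEqPow α t u w := by
  rw [LinearMap.mem_ker, shiftDiff_apply, sub_eq_zero]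
  constructor
  · intro e
    refine ⟨h.rep (α ^ t * y), h.rep y, h.natDegree_rep_lt _, h.natDegree_rep_lt _, h.aeval_rep y,
      ?_, ?_⟩
    · rw [h.aeval_rep, h.aeval_rep]
    · exact e.symm
  · rintro ⟨u, w, hu, hw, rfl, h1, h2⟩
    rw [← h1, invMap_apply, invMap_apply, h.rep_aeval hu, h.rep_aeval hw, h2]

/-- Fractions of small degree are determined by their values at `α` and `α⁻¹`. -/
theorem mul_eq_mul_of_ratioEqPow {t : ℕ} {u w u' w' : (ZMod 2)[X]} (e : RatioEqPow α t u w)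
    (e' : RatioEqPow α t u' w') (hd : u.natDegree + w'.natDegree < 2 * n)
    (hd' : u'.natDegree + w.natDegree < 2 * n) : u * w' = u' * w := by
  rw [← sub_eq_zero]
  have ht := pow_ne_zero t h.ne_zero
  apply h.eq_zero_of_aeval_of_aeval_inv
  · refine (natDegree_sub_le _ _).trans_lt (max_lt ?_ ?_)
    · exact natDegree_mul_le.trans_lt hd
    · exact natDegree_mul_le.trans_lt hd'
  · rw [map_sub, map_mul, map_mul, e.1, e'.1]
    ring
  · rw [map_sub, map_mul, map_mul, e.2, e'.2]
    ring

/-- The kernel of `shiftDiff t` consists of the values at `α` of `g * w` with `deg g < n - k`, since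
the pairs in `mem_ker_shiftDiff` are exactly the multiples `(g * u, g * w)` of small degree. -/
theorem finrank_range_shiftDiff {t k : ℕ} {u w : (ZMod 2)[X]} (huw : IsCoprime u w)
    (hk : max u.natDegree w.natDegree = k) (hkn : k < n) (e : RatioEqPow α t u w) :
    Module.finrank (ZMod 2) (LinearMap.range (h.shiftDiff t)) = k := by
  have := h.finiteDimensional
  have hu : u.natDegree ≤ k := hk ▸ le_max_left _ _
  have hw : w.natDegree ≤ k := hk ▸ le_max_right _ _
  have hw0 : w ≠ 0 := by
    rintro rfl
    have hu0 := h.eq_zero_of_aeval (hu.trans_lt hkn) (by rw [e.1, map_zero, mul_zero])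
    rw [hu0] at huw
    exact not_isCoprime_zero_zero huw
  have hu0 : u ≠ 0 := by
    rintro rfl
    exact hw0 (h.eq_zero_of_aeval_inv (hw.trans_lt hkn) (by rw [e.2, map_zero, mul_zero]))
  let M : degreeLT (ZMod 2) (n - k) →ₗ[ZMod 2] F :=
    (aeval α).toLinearMap ∘ₗ LinearMap.mulRight (ZMod 2) w ∘ₗ (degreeLT (ZMod 2) (n - k)).subtype
  have hM : ∀ g, M g = aeval α ((g : (ZMod 2)[X]) * w) := fun g => rfl
  have hlt : ∀ g : degreeLT (ZMod 2) (n - k), (g : (ZMod 2)[X]).natDegree < n - k := fun g =>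
    (mem_degreeLT_iff_natDegree_lt (by omega)).1 g.2
  have hMinj : Function.Injective M := by
    rw [← LinearMap.ker_eq_bot, LinearMap.ker_eq_bot']
    intro g hg
    have := hlt g
    have h0 := h.eq_zero_of_aeval (natDegree_mul_le.trans_lt (by omega)) (hM g ▸ hg)
    exact Subtype.ext ((mul_eq_zero.1 h0).resolve_right hw0)
  have hMrange : LinearMap.range M = LinearMap.ker (h.shiftDiff t) := by
    ext y
    rw [h.mem_ker_shiftDiff, LinearMap.mem_range]
    constructor
    · rintro ⟨g, rfl⟩
      have := hlt g
      refine ⟨g * u, g * w, natDegree_mul_le.trans_lt (by omega),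
        natDegree_mul_le.trans_lt (by omega), rfl, ?_, ?_⟩
      · rw [map_mul, map_mul, e.1]
        ring
      · rw [map_mul, map_mul, e.2]
        ring
    · rintro ⟨u', w', hu', hw', rfl, e'⟩
      have hmul := h.mul_eq_mul_of_ratioEqPow e e' (by omega) (by omega)
      obtain ⟨g, rfl⟩ : w ∣ w' := huw.symm.dvd_of_dvd_mul_left ⟨u', by rw [hmul, mul_comm]⟩
      have hgu : u' = u * g := mul_right_cancel₀ hw0 (by rw [← hmul]; ring)
      refine ⟨⟨g, ?_⟩, by rw [hM, mul_comm]⟩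
      rw [mem_degreeLT_iff_natDegree_lt (by omega)]
      by_cases hg : g = 0
      · rw [hg, natDegree_zero]
        omega
      rw [hgu, natDegree_mul hu0 hg] at hu'
      rw [natDegree_mul hw0 hg] at hw'
      omega
  have h1 := LinearMap.finrank_range_of_inj hMinj
  rw [finrank_degreeLT_zmod_two, hMrange] at h1
  have h2 := (h.shiftDiff t).finrank_range_add_finrank_ker
  rw [h.finrank_eq] at h2
  omega

theorem exists_isCoprime_ratioEqPow {t : ℕ}
    (ht : Module.finrank (ZMod 2) (LinearMap.range (h.shiftDiff t)) < n) :
    ∃ u w : (ZMod 2)[X], IsCoprime u w ∧ u.natDegree < n ∧ w.natDegree < n ∧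
      RatioEqPow α t u w := by
  have := h.finiteDimensional
  have h2 := (h.shiftDiff t).finrank_range_add_finrank_ker
  rw [h.finrank_eq] at h2
  have hker : LinearMap.ker (h.shiftDiff t) ≠ ⊥ := by
    intro h0
    rw [h0, finrank_bot] at h2
    omega
  obtain ⟨y, hy, hy0⟩ := Submodule.exists_mem_ne_zero_of_ne_bot hker
  obtain ⟨u, w, hu, hw, rfl, e⟩ := h.mem_ker_shiftDiff.1 hy
  have hw0 : w ≠ 0 := by
    rintro rfl
    exact hy0 (map_zero _)
  obtain ⟨g, v, v', hvw, hv, hw'⟩ := exists_eq_mul_isCoprime u hw0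
  subst hv hw'
  have hv'0 := right_ne_zero_of_mul hw0
  have hg := left_ne_zero_of_mul hw0
  have hgd : g.natDegree < n := by
    rw [natDegree_mul hg hv'0] at hw
    omega
  have hg1 : aeval α g ≠ 0 := fun h0 => hg (h.eq_zero_of_aeval hgd h0)
  have hg2 : aeval α⁻¹ g ≠ 0 := fun h0 => hg (h.eq_zero_of_aeval_inv hgd h0)
  refine ⟨v, v', hvw, ?_, ?_, mul_left_cancel₀ hg1 ?_, mul_left_cancel₀ hg2 ?_⟩
  · by_cases hv0 : v = 0
    · rw [hv0, natDegree_zero]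
      exact h.pos
    · rw [natDegree_mul hg hv0] at hu
      omega
  · rw [natDegree_mul hg hv'0] at hw
    omega
  · rw [← map_mul, e.1, map_mul]
    ring
  · rw [← map_mul, e.2, map_mul]
    ring

/-- Reversing and exchanging numerator and denominator does not change the values at `α` and `α⁻¹`,
so by uniqueness of fractions `u / w` equals `reflect k w / reflect k u`. -/
theorem coprimeToReversal_of_ratioEqPow {t : ℕ} {u w : (ZMod 2)[X]} (huw : IsCoprime u w)
    (hu : u.natDegree < n) (hw : w.natDegree < n) (e : RatioEqPow α t u w) :
    ∃ k < n, CoprimeToReversal k u ∧ RatioEqPow α t u (reflect k u) := by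
  obtain ⟨k, hk⟩ : ∃ k, max u.natDegree w.natDegree = k := ⟨_, rfl⟩
  have huk : u.natDegree ≤ k := by omega
  have hwk : w.natDegree ≤ k := by omega
  have hru := natDegree_reflect_le_of_le huk
  have hrw := natDegree_reflect_le_of_le hwk
  have e' : RatioEqPow α t (reflect k w) (reflect k u) := by
    have hk0 := pow_ne_zero k h.ne_zero
    constructor
    · rw [aeval_reflect h.ne_zero hwk, aeval_reflect h.ne_zero huk, e.2]
      ring
    · refine mul_left_cancel₀ hk0 ?_
      rw [mul_left_comm, aeval_inv_reflect h.ne_zero hwk, aeval_inv_reflect h.ne_zero huk, e.1]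
  have hr : reflect k u = w := by
    refine reflect_eq_of_isCoprime huw hk ?_
    rw [h.mul_eq_mul_of_ratioEqPow e e' (by omega) (by omega), mul_comm]
  exact ⟨k, by omega, ⟨hr ▸ huw, hr ▸ hk⟩, hr ▸ e⟩

theorem exists_ratioEqPow_reflect {k : ℕ} (hk : k < n) {v : (ZMod 2)[X]}
    (hv : CoprimeToReversal k v) :
    ∃ t ∈ Finset.Icc 1 (2 ^ n - 1), RatioEqPow α t v (reflect k v) := by
  have := h.finite
  have := Fintype.ofFinite F
  have hvk := hv.natDegree_le
  have hrk := natDegree_reflect_le_of_le hvk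
  have h1 : aeval α v ≠ 0 := fun h0 => hv.ne_zero (h.eq_zero_of_aeval (by omega) h0)
  have h2 : aeval α (reflect k v) ≠ 0 := fun h0 => hv.ne_zero
    ((reflect_eq_zero_iff (N := k)).1 (h.eq_zero_of_aeval (by omega) h0))
  have hN : 0 < 2 ^ n - 1 := by
    have : 2 ^ 1 ≤ 2 ^ n := Nat.pow_le_pow_right (by norm_num) h.pos
    omega
  have : NeZero (2 ^ n - 1) := ⟨hN.ne'⟩
  have hprim : IsPrimitiveRoot α (2 ^ n - 1) := h.orderOf_eq ▸ IsPrimitiveRoot.orderOf α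
  obtain ⟨i, hi, hpow⟩ := hprim.eq_pow_of_pow_eq_one
    (ξ := aeval α v / aeval α (reflect k v)) (by
      rw [← h.natCard_eq, Nat.card_eq_fintype_card]
      exact FiniteField.pow_card_sub_one_eq_one _ (div_ne_zero h1 h2))
  obtain ⟨t, ht, htpow⟩ : ∃ t ∈ Finset.Icc 1 (2 ^ n - 1), α ^ t = α ^ i := by
    rcases Nat.eq_zero_or_pos i with rfl | hi0
    -- The exponent `0` lies outside the range `1 ≤ t ≤ 2 ^ n - 1` and is represented by its end.
    · exact ⟨2 ^ n - 1, Finset.mem_Icc.2 ⟨hN, le_rfl⟩, by rw [hprim.pow_eq_one, pow_zero]⟩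
    · exact ⟨i, Finset.mem_Icc.2 ⟨hi0, hi.le⟩, rfl⟩
  have e1 : aeval α v = α ^ t * aeval α (reflect k v) := by
    rw [htpow, hpow, div_mul_cancel₀ _ h2]
  refine ⟨t, ht, e1, mul_left_cancel₀ (pow_ne_zero k h.ne_zero) ?_⟩
  rw [aeval_inv_reflect h.ne_zero hvk, mul_left_comm, ← aeval_reflect h.ne_zero hvk, e1]

theorem eq_of_pow_eq_pow {t t' : ℕ} (ht : t ∈ Finset.Icc 1 (2 ^ n - 1))
    (ht' : t' ∈ Finset.Icc 1 (2 ^ n - 1)) (e : α ^ t = α ^ t') : t = t' := by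
  wlog hle : t ≤ t' generalizing t t'
  · exact (this ht' ht e.symm (by omega)).symm
  rw [Finset.mem_Icc] at ht ht'
  have h1 : α ^ (t' - t) = 1 := by
    refine mul_left_cancel₀ (pow_ne_zero t h.ne_zero) ?_
    rw [← pow_add, Nat.add_sub_cancel' hle, e, mul_one]
  have h2 := Nat.eq_zero_of_dvd_of_lt (h.orderOf_eq ▸ orderOf_dvd_of_pow_eq_one h1) (by omega)
  omega

/-- The exponents `t` with rank `k < n` correspond to the forms `v` of degree `k` coprime to their
reversal, through `v / reflect k v = α ^ t` at `α`. -/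
theorem gramRankCount_eq {s : ℕ → ZMod 2} {b : F} (hb : b ≠ 0)
    (hs : ∀ i, s i = h.topCoeff (α ^ i * b)) {k : ℕ} (hk : k < n) :
    gramRankCount s n k = (coprimeForms k).card := by
  have hex : ∀ t, gramRank s n t = k →
      ∃ v, CoprimeToReversal k v ∧ RatioEqPow α t v (reflect k v) := fun t ht => by
    rw [h.gramRank_eq hb hs] at ht
    obtain ⟨u, w, huw, hu, hw, e⟩ := h.exists_isCoprime_ratioEqPow (ht ▸ hk)
    obtain ⟨j, hj, hju, e'⟩ := h.coprimeToReversal_of_ratioEqPow huw hu hw e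
    rw [h.finrank_range_shiftDiff hju.1 hju.2 hj e'] at ht
    subst ht
    exact ⟨u, hju, e'⟩
  choose! v hv using hex
  refine Finset.card_bij (fun t _ => v t) ?_ ?_ ?_
  · intro t ht
    exact mem_coprimeForms.2 (hv t (Finset.mem_filter.1 ht).2).1
  · intro t ht t' ht' e
    rw [Finset.mem_filter] at ht ht'
    obtain ⟨h1, h2, -⟩ := hv t ht.2
    obtain ⟨-, h2', -⟩ := hv t' ht'.2
    refine h.eq_of_pow_eq_pow ht.1 ht'.1 (mul_right_cancel₀ (fun h0 => h1.ne_zero ?_)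
      (h2.symm.trans (e ▸ h2')))
    have := natDegree_reflect_le_of_le h1.natDegree_le
    exact (reflect_eq_zero_iff (N := k)).1 (h.eq_zero_of_aeval (by omega) h0)
  · intro w hw
    rw [mem_coprimeForms] at hw
    obtain ⟨t, ht, e⟩ := h.exists_ratioEqPow_reflect hk hw
    have hrank : gramRank s n t = k := by
      rw [h.gramRank_eq hb hs, h.finrank_range_shiftDiff hw.1 hw.2 hk e]
    obtain ⟨h1, h2⟩ := hv t hrank
    have := hw.natDegree_le
    have := h1.natDegree_le
    have := natDegree_reflect_le_of_le h1.natDegree_le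
    have := natDegree_reflect_le_of_le hw.natDegree_le
    exact ⟨t, Finset.mem_filter.2 ⟨ht, hrank⟩,
      (eq_of_mul_reflect_eq h1 hw (h.mul_eq_mul_of_ratioEqPow h2 e (by omega) (by omega))).1⟩

end IsPrimitiveElement

/-! ### The rank distribution -/

theorem sum_gramRankCount (s : ℕ → ZMod 2) (n : ℕ) :
    ∑ k ∈ Finset.range (n + 1), gramRankCount s n k = 2 ^ n - 1 := by
  have := Finset.card_eq_sum_card_fiberwise (s := Finset.Icc 1 (2 ^ n - 1))
    (t := Finset.range (n + 1)) (f := gramRank s n) (by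
      intro t _
      have := Matrix.rank_le_height
        (observabilityMatrix s n t * (observabilityMatrix s n t).transpose)
      exact Finset.mem_coe.2 (Finset.mem_range.2 (Nat.lt_succ_of_le this)))
  rw [Nat.card_Icc, Nat.add_sub_cancel] at this
  exact this.symm

theorem theorem1 (n : ℕ) (hn : 3 ≤ n) (s : ℕ → ZMod 2) (hs : IsMSequence n s) :
    gramRankCount s n 0 = 1 ∧
    gramRankCount s n 1 = 2 ∧
    (∀ k : ℕ, 2 ≤ k → k ≤ n - 1 → gramRankCount s n k = 2 ^ (k - 1)) ∧
    gramRankCount s n n = 2 ^ (n - 1) - 2 := by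
  obtain ⟨hs0, E, hE, ⟨hdeg, α, hα, hmin⟩, hsol⟩ := hs
  have h : IsPrimitiveElement n α :=
    ⟨hn, GaloisField.finrank 2 (by omega), hα, hmin ▸ hdeg⟩
  obtain ⟨b, hb, hsb⟩ := h.exists_eq_topCoeff E (hmin ▸ minpoly.aeval _ _) hE hsol hs0
  have key : ∀ k < n, gramRankCount s n k = (coprimeForms k).card := fun k hk =>
    h.gramRankCount_eq hb hsb hk
  refine ⟨?_, ?_, fun k hk hkn => ?_, ?_⟩
  · rw [key 0 (by omega), card_coprimeForms_zero]
  · rw [key 1 (by omega), card_coprimeForms_one]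
  · rw [key k (by omega), card_coprimeForms hk]
  · have h1 := sum_gramRankCount s n
    obtain ⟨m, rfl⟩ : ∃ m, n = m + 1 := ⟨n - 1, by omega⟩
    rw [Finset.sum_range_succ, Finset.sum_congr rfl fun k hk => key k (Finset.mem_range.1 hk),
      sum_card_coprimeForms (by omega), pow_succ] at h1
    rw [Nat.add_sub_cancel]
    omega
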